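/- Let $\mathcal X,\mathcal Y$ be finite alphabets, $\mathcal H$ a finite-dimensional complex Hilbert space with set of density operators $\mathcal S(\mathcal H)$, and $W:\mathcal X\times\mathcal Y\to\mathcal S(\mathcal H)$. The discrete memoryless classical-classical-quantum (DM-CCQ) channel generated by $W$ is the family $W^k(x^k,y^k)=\bigotimes_{i=1}^k W(x_i,y_i)\in\mathcal S(\mathcal H^{\otimes k})$, $x^k\in\mathcal X^k$, $y^k\in\mathcal Y^k$, $k\in\mathbb N$. Logarithms are to base $2$, and $M,N\ge 1$ are integers. A $(k,M,N)$-code consists of $x_1,\dots,x_M\in\mathcal X^k$, $y_1,\dots,y_N\in\mathcal Y^k$ and a POVM $(D_{mn})_{m\le M,\,n\le N}$ on $\mathcal H^{\otimes k}$; its average error is $\overline e=1-\frac1{MN}\sum_{m,n}\operatorname{tr}(D_{mn}W^k(x_m,y_n))$. The transmission capacity region $C(W)$ is the set of all $(R_1,R_2)\in\mathbb R^2$, $R_1,R_2\ge 0$, such that for all $\epsilon,\delta>0$ there is a $k_0$ such that for all $k\ge k_0$ there are $M,N$ and a $(k,M,N)$-code with $\frac1k\log M\ge R_1-\delta$, $\frac1k\log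 N\ge R_2-\delta$ and $\overline e\le\epsilon$. A $(k,M,N)$-ID-code consists of probability distributions $P_1,\dots,P_M$ on $\mathcal X^k$ and $Q_1,\dots,Q_N$ on $\mathcal Y^k$ and operators $0\le I_{mn}\le\mathbb 1$ on $\mathcal H^{\otimes k}$ $(m\le M,\ n\le N)$; its errors of the first and second kind are $$e_1=\max_{m,n}\Bigl(1-\sum_{x^k,y^k}P_m(x^k)Q_n(y^k)\operatorname{tr}(I_{mn}W^k(x^k,y^k))\Bigr),$$ $$e_2=\max_{(m,n)\ne(m',n')}\sum_{x^k,y^k}P_m(x^k)Q_n(y^k)\operatorname{tr}(I_{m'n'}W^k(x^k,y^k)),$$ where $e_2=0$ if $M=N=1$. The (non-simultaneous) identification capacity region $C_{\mathrm{id}}(W)$ is the set of all $(R_1,R_2)\in\mathbb R^2$, $R_1,R_2\ge0$, such that for all $\epsilon_1,\epsilon_2,\delta>0$ there is a $k_0$ such that for all $k\ge k_0$ there are $M,N$ and a $(k,M,N)$-ID-code with $\frac1k\log\log M\ge R_1-\delta$, $\frac1k\log\log N\ge R_2-\delta$, $e_1\le\epsilon_1$ and $e_2\le\epsilon_2$.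 Here $\log\log 1$ is read as $0$, that is, a sender with a single message has identification rate $0$. Then for every DM-CCQ channel, $C(W)\subseteq C_{\mathrm{id}}(W)$. -/

import Mathlib

namespace CCQ

open scoped Matrix ComplexOrder

/-- A quantum state on the Hilbert space `ℂ^n` (with `n` an index set of an orthonormal basis):
a positive semidefinite matrix of trace one. -/
structure State (n : Type*) [Fintype n] where
  mat : Matrix n n ℂ
  posSemidef : mat.PosSemidef
  trace_eq_one : mat.trace = 1

/-- The tensor product `A₁ ⊗ ⋯ ⊗ A_k` of operators on `ℂ^ι`, as an operator on
`(ℂ^ι)^{⊗ k} = ℂ^(ι^k)`, in the product basis. -/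
def tensor {ι : Type*} {k : ℕ} (A : Fin k → Matrix ι ι ℂ) :
    Matrix (Fin k → ι) (Fin k → ι) ℂ :=
  Matrix.of fun a b => ∏ i, A i (a i) (b i)

theorem tensor_mul {ι : Type*} [Fintype ι] {k : ℕ} (A B : Fin k → Matrix ι ι ℂ) :
    tensor A * tensor B = tensor fun i => A i * B i := by
  ext a b
  simp only [tensor, Matrix.mul_apply, Matrix.of_apply, ← Finset.prod_mul_distrib]
  rw [Finset.prod_univ_sum, Fintype.piFinset_univ]

theorem tensor_conjTranspose {ι : Type*} {k : ℕ} (A : Fin k → Matrix ι ι ℂ) :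
    (tensor A)ᴴ = tensor fun i => (A i)ᴴ := by
  ext a b
  simp [tensor, Matrix.conjTranspose_apply]

theorem trace_tensor {ι : Type*} [Fintype ι] {k : ℕ} (A : Fin k → Matrix ι ι ℂ) :
    (tensor A).trace = ∏ i, (A i).trace := by
  simp only [Matrix.trace, Matrix.diag_apply, tensor, Matrix.of_apply]
  rw [Finset.prod_univ_sum, Fintype.piFinset_univ]

open scoped MatrixOrder Matrix.Norms.L2Operator in
theorem tensor_posSemidef {ι : Type*} [Fintype ι] {k : ℕ} (A : Fin k → Matrix ι ι ℂ)
    (hA : ∀ i, (A i).PosSemidef) : (tensor A).PosSemidef := by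
  classical
  have h : ∀ i, ∃ B : Matrix ι ι ℂ, A i = Bᴴ * B := fun i => by
    obtain ⟨B, hB⟩ := CStarAlgebra.nonneg_iff_eq_star_mul_self.mp (hA i).nonneg
    exact ⟨B, hB⟩
  choose B hB using h
  have : tensor A = (tensor B)ᴴ * tensor B := by
    rw [tensor_conjTranspose, tensor_mul]
    exact congrArg tensor (funext hB)
  rw [this]
  exact Matrix.posSemidef_conjTranspose_mul_self _

/-- The product state `ρ₁ ⊗ ⋯ ⊗ ρ_k`. -/
def State.tensor {ι : Type*} [Fintype ι] {k : ℕ} (ρ : Fin k → State ι) :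
    State (Fin k → ι) where
  mat := CCQ.tensor fun i => (ρ i).mat
  posSemidef := tensor_posSemidef _ fun i => (ρ i).posSemidef
  trace_eq_one := by simp [trace_tensor, State.trace_eq_one]

/-- A CCQ channel: a family of maps `W^k : X^k × Y^k → S(H^{⊗ k})`, `k ∈ ℕ`,
where `H = ℂ^ι`. -/
def Channel (X Y ι : Type*) [Fintype ι] :=
  ∀ k : ℕ, (Fin k → X) → (Fin k → Y) → State (Fin k → ι)

/-- The DM-CCQ channel generated by `W : X × Y → S(H)`:
`W^k(x^k, y^k) = W(x₁, y₁) ⊗ ⋯ ⊗ W(x_k, y_k)`. -/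
def memoryless {X Y ι : Type*} [Fintype ι] (W : X → Y → State ι) : Channel X Y ι :=
  fun _ x y => State.tensor fun i => W (x i) (y i)

/-- The probability `tr(E ρ)` of the effect `E` in the state `ρ`
(a real number whenever `E` is Hermitian). -/
noncomputable def prob {n : Type*} [Fintype n] (E : Matrix n n ℂ) (ρ : State n) : ℝ :=
  (E * ρ.mat).trace.re

/-- A `(k, M, N)`-code for message transmission: codewords `x_m ∈ X^k`, `y_n ∈ Y^k`
and a POVM `(D_{mn})` on `H^{⊗ k}`. -/
structure Code (X Y ι : Type*) [Fintype ι] [DecidableEq ι] (k M N : ℕ) where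
  x : Fin M → Fin k → X
  y : Fin N → Fin k → Y
  D : Fin M → Fin N → Matrix (Fin k → ι) (Fin k → ι) ℂ
  D_posSemidef : ∀ m n, (D m n).PosSemidef
  sum_D : ∑ m, ∑ n, D m n = 1

/-- The average error of transmission of a code over `W^k`. -/
noncomputable def Code.avgError {X Y ι : Type*} [Fintype ι] [DecidableEq ι] {k M N : ℕ}
    (c : Code X Y ι k M N) (W : Channel X Y ι) : ℝ :=
  1 - 1 / ((M : ℝ) * (N : ℝ)) * ∑ m, ∑ n, prob (c.D m n) (W k (c.x m) (c.y n))

/-- Achievable rate pairs for message transmission under the average error criterion. -/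
def IsAchievable {X Y ι : Type*} [Fintype ι] [DecidableEq ι]
    (W : Channel X Y ι) (R₁ R₂ : ℝ) : Prop :=
  0 ≤ R₁ ∧ 0 ≤ R₂ ∧ ∀ ε δ : ℝ, 0 < ε → 0 < δ → ∃ k₀ : ℕ, ∀ k : ℕ, k₀ ≤ k →
    ∃ M N : ℕ, 1 ≤ M ∧ 1 ≤ N ∧ ∃ c : Code X Y ι k M N,
      R₁ - δ ≤ 1 / (k : ℝ) * Real.logb 2 M ∧
      R₂ - δ ≤ 1 / (k : ℝ) * Real.logb 2 N ∧
      c.avgError W ≤ ε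

/-- The transmission capacity region `C(W)`. -/
def capacityRegion {X Y ι : Type*} [Fintype ι] [DecidableEq ι]
    (W : Channel X Y ι) : Set (ℝ × ℝ) :=
  {R | IsAchievable W R.1 R.2}

/-- A `(k, M, N)`-ID-code: probability distributions `P_m` on `X^k` and `Q_n` on `Y^k`, and
operators `0 ≤ I_{mn} ≤ 1` on `H^{⊗ k}`. -/
structure IDCode (X Y ι : Type*) [Fintype X] [Fintype Y] [Fintype ι] [DecidableEq ι]
    (k M N : ℕ) where
  P : Fin M → (Fin k → X) → ℝ
  P_mem : ∀ m, P m ∈ stdSimplex ℝ (Fin k → X)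
  Q : Fin N → (Fin k → Y) → ℝ
  Q_mem : ∀ n, Q n ∈ stdSimplex ℝ (Fin k → Y)
  I : Fin M → Fin N → Matrix (Fin k → ι) (Fin k → ι) ℂ
  I_nonneg : ∀ m n, (I m n).PosSemidef
  I_le_one : ∀ m n, (1 - I m n).PosSemidef

/-- The probability that the test for the pair `t = (m', n')` accepts when the pair
`s = (m, n)` is sent: `∑_{x^k, y^k} P_m(x^k) Q_n(y^k) tr(I_{m'n'} W^k(x^k, y^k))`. -/
noncomputable def IDCode.acceptProb {X Y ι : Type*} [Fintype X] [Fintype Y] [Fintype ι]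
    [DecidableEq ι] {k M N : ℕ} (c : IDCode X Y ι k M N) (W : Channel X Y ι)
    (s t : Fin M × Fin N) : ℝ :=
  ∑ x : Fin k → X, ∑ y : Fin k → Y, c.P s.1 x * c.Q s.2 y * prob (c.I t.1 t.2) (W k x y)

/-- The error of the first kind: the maximal probability of rejecting the pair that was sent. -/
noncomputable def IDCode.error₁ {X Y ι : Type*} [Fintype X] [Fintype Y] [Fintype ι]
    [DecidableEq ι] {k M N : ℕ} (c : IDCode X Y ι k M N) (W : Channel X Y ι) : ℝ :=
  ⨆ s : Fin M × Fin N, (1 - c.acceptProb W s s)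

/-- The error of the second kind: the maximal probability of accepting a pair different from
the one that was sent. It is `0` if there is only one pair. -/
noncomputable def IDCode.error₂ {X Y ι : Type*} [Fintype X] [Fintype Y] [Fintype ι]
    [DecidableEq ι] {k M N : ℕ} (c : IDCode X Y ι k M N) (W : Channel X Y ι) : ℝ :=
  ⨆ p : {p : (Fin M × Fin N) × (Fin M × Fin N) // p.1 ≠ p.2}, c.acceptProb W p.1.1 p.1.2

/-- `log log M` to base two, with the convention `log log 1 = 0`: a sender who has just one
message has identification rate zero. -/
noncomputable def logLog (M : ℕ) : ℝ :=
  if M ≤ 1 then 0 else Real.logb 2 (Real.logb 2 M)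

/-- Achievable ID-rate pairs. -/
def IsIDAchievable {X Y ι : Type*} [Fintype X] [Fintype Y] [Fintype ι] [DecidableEq ι]
    (W : Channel X Y ι) (R₁ R₂ : ℝ) : Prop :=
  0 ≤ R₁ ∧ 0 ≤ R₂ ∧ ∀ ε₁ ε₂ δ : ℝ, 0 < ε₁ → 0 < ε₂ → 0 < δ → ∃ k₀ : ℕ, ∀ k : ℕ, k₀ ≤ k →
    ∃ M N : ℕ, 1 ≤ M ∧ 1 ≤ N ∧ ∃ c : IDCode X Y ι k M N,
      R₁ - δ ≤ 1 / (k : ℝ) * logLog M ∧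
      R₂ - δ ≤ 1 / (k : ℝ) * logLog N ∧
      c.error₁ W ≤ ε₁ ∧ c.error₂ W ≤ ε₂

/-- The identification capacity region `C_id(W)`. -/
def idCapacityRegion {X Y ι : Type*} [Fintype X] [Fintype Y] [Fintype ι] [DecidableEq ι]
    (W : Channel X Y ι) : Set (ℝ × ℝ) :=
  {R | IsIDAchievable W R.1 R.2}

end CCQ

/-!
A transmission code for `W` with small *average* error is turned into an identification code in the
manner of Ahlswede and Dueck: the message pair `(m, n)` is sent as a uniformly chosen pair of
transmission messages from a product set `U m ×ˢ V n`, and the test for `(m, n)` accepts if the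
decoded pair lies in that set. The error of the first kind is at most the average of the
transmission error `e` over `U m ×ˢ V n`. The error of the second kind is at most this average plus
the relative size of the overlap of two of the product sets.

Doubly exponentially many subsets with small relative overlaps are the graphs of the words of a
code with large Hamming distance over a fixed alphabet (`exists_code_small_agreement`,
`exists_set_family`). As only the average error of the transmission code is small, such sets may
consist of bad pairs, and a union bound over doubly exponentially many of them is not available if
the two rates differ. Therefore the messages of the first sender are first joined into groups of
size linear in the block length, at no cost in rate. By a Chernoff bound there is a grouping such
that the error, averaged over a group, is small for *every* group and for *every* message of the
second sender outside a set of bad ones (`exists_shift`, `exists_grouping`); the union bound runs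
over singly exponentially many pairs only, because the dimension bounds the number of messages
(`Code.card_mul_card_le`). Then all unions of groups and all sets of good messages of the
second sender have small average error (`exists_id_families`), so the sets `U m` and `V n` can be
chosen freely.
-/

namespace CCQ

open scoped Matrix ComplexOrder

/-! ### Grouping the messages of one sender -/

/-- If every `b ∈ S` has mean at most `μ` over the array `f · · b` of width `s` and length `L`, then
the columns of the array can be shifted cyclically so that in all rows, for all `b ∈ S`, the mean
is at most `3 * μ`. Independent uniformly distributed shifts have this property with positive
probability, by Chernoff's bound. -/
theorem exists_shift {β : Type*} {s L : ℕ} [NeZero L] (S : Finset β)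
    (f : Fin s → Fin L → β → ℝ) (hf₀ : ∀ j x b, 0 ≤ f j x b) (hf₁ : ∀ j x b, f j x b ≤ 1)
    {μ : ℝ} (hμ : ∀ b ∈ S, ∑ j, ∑ x, f j x b ≤ μ * (s * L))
    (hS : L * S.card * Real.exp (-(μ * s)) < 1) :
    ∃ r : Fin s → Fin L, ∀ l, ∀ b ∈ S, ∑ j, f j (l + r j) b ≤ 3 * μ * s := by
  by_contra! hbad
  have hL : (0 : ℝ) < L := Nat.cast_pos.2 (Nat.pos_of_neZero L)
  have hmgf : ∀ l : Fin L, ∀ b ∈ S,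
      ∑ r : Fin s → Fin L, Real.exp (∑ j, f j (l + r j) b - 3 * μ * s) ≤
        (L : ℝ) ^ s * Real.exp (-(μ * s)) := by
    intro l b hb
    -- the sum over `r` factorizes, as the columns are shifted independently
    have hcol : ∀ j, ∑ x, Real.exp (f j (l + x) b) ≤
        L * Real.exp (2 * ((∑ x, f j x b) / L)) := by
      intro j
      have h1 : ∀ x, Real.exp (f j x b) ≤ 1 + 2 * f j x b := by
        intro x
        have := Real.abs_exp_sub_one_le (x := f j x b)
          (by rw [abs_of_nonneg (hf₀ j x b)]; exact hf₁ j x b)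
        rw [abs_of_nonneg (hf₀ j x b)] at this
        linarith [le_abs_self (Real.exp (f j x b) - 1)]
      calc ∑ x, Real.exp (f j (l + x) b) = ∑ x, Real.exp (f j x b) :=
            Equiv.sum_comp (Equiv.addLeft l) fun x => Real.exp (f j x b)
        _ ≤ ∑ x, (1 + 2 * f j x b) := Finset.sum_le_sum fun x _ => h1 x
        _ = L * (2 * ((∑ x, f j x b) / L) + 1) := by
            rw [Finset.sum_add_distrib, ← Finset.mul_sum]
            simp only [Finset.sum_const, Finset.card_univ, Fintype.card_fin, nsmul_eq_mul]
            field_simp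
            ring
        _ ≤ _ := mul_le_mul_of_nonneg_left (Real.add_one_le_exp _) hL.le
    calc ∑ r : Fin s → Fin L, Real.exp (∑ j, f j (l + r j) b - 3 * μ * s)
        = (∏ j, ∑ x, Real.exp (f j (l + x) b)) * Real.exp (-(3 * μ * s)) := by
          rw [Finset.prod_univ_sum, Fintype.piFinset_univ, Finset.sum_mul]
          refine Finset.sum_congr rfl fun r _ => ?_
          rw [sub_eq_add_neg, Real.exp_add, Real.exp_sum]
      _ ≤ (∏ j : Fin s, (L * Real.exp (2 * ((∑ x, f j x b) / L)))) * Real.exp (-(3 * μ * s)) := by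
          gcongr with j
          exact hcol j
      _ = (L : ℝ) ^ s * Real.exp (2 * ((∑ j, ∑ x, f j x b) / L) + -(3 * μ * s)) := by
          rw [Finset.prod_mul_distrib, ← Real.exp_sum, ← Finset.mul_sum, ← Finset.sum_div,
            Real.exp_add]
          simp [mul_assoc]
      _ ≤ _ := by
          gcongr
          have : (∑ j, ∑ x, f j x b) / L ≤ μ * s := by
            rw [div_le_iff₀ hL]; linarith [hμ b hb]
          linarith
  have hone : ∀ r : Fin s → Fin L,
      (1 : ℝ) ≤ ∑ l, ∑ b ∈ S, Real.exp (∑ j, f j (l + r j) b - 3 * μ * s) := by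
    intro r
    obtain ⟨l, b, hb, hlt⟩ := hbad r
    calc (1 : ℝ) ≤ Real.exp (∑ j, f j (l + r j) b - 3 * μ * s) :=
          Real.one_le_exp (by linarith)
      _ ≤ ∑ b ∈ S, Real.exp (∑ j, f j (l + r j) b - 3 * μ * s) :=
          Finset.single_le_sum (f := fun b => Real.exp (∑ j, f j (l + r j) b - 3 * μ * s))
            (fun _ _ => (Real.exp_pos _).le) hb
      _ ≤ _ := Finset.single_le_sum
            (f := fun l => ∑ b ∈ S, Real.exp (∑ j, f j (l + r j) b - 3 * μ * s))
            (fun _ _ => Finset.sum_nonneg fun _ _ => (Real.exp_pos _).le) (Finset.mem_univ l)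
  have hcontra : (L : ℝ) ^ s ≤ (L : ℝ) ^ s * (L * S.card * Real.exp (-(μ * s))) := by
    calc (L : ℝ) ^ s = ∑ r : Fin s → Fin L, (1 : ℝ) := by simp
      _ ≤ ∑ r : Fin s → Fin L, ∑ l, ∑ b ∈ S, Real.exp (∑ j, f j (l + r j) b - 3 * μ * s) :=
          Finset.sum_le_sum fun r _ => hone r
      _ = ∑ l, ∑ b ∈ S, ∑ r : Fin s → Fin L, Real.exp (∑ j, f j (l + r j) b - 3 * μ * s) := by
          rw [Finset.sum_comm]
          exact Finset.sum_congr rfl fun l _ => Finset.sum_comm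
      _ ≤ ∑ l : Fin L, ∑ b ∈ S, (L : ℝ) ^ s * Real.exp (-(μ * s)) :=
          Finset.sum_le_sum fun l _ => Finset.sum_le_sum fun b hb => hmgf l b hb
      _ = _ := by simp; ring
  have := mul_lt_mul_of_pos_left hS (pow_pos hL s)
  linarith

/-- Markov's inequality: at least half of the points have values at most twice the mean. -/
theorem card_le_two_mul_card_filter_le {β : Type*} [Fintype β] (f : β → ℝ)
    (hf : ∀ b, 0 ≤ f b) {t : ℝ} (ht : 0 < t)
    (hsum : ∑ b, f b ≤ t / 2 * Fintype.card β) :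
    Fintype.card β ≤ 2 * (Finset.univ.filter fun b => f b ≤ t).card := by
  have hsplit := Finset.card_filter_add_card_filter_not (s := (Finset.univ : Finset β))
    (fun b => f b ≤ t)
  have hbad : ((Finset.univ.filter fun b => ¬ f b ≤ t).card : ℝ) * t ≤ ∑ b, f b := by
    rw [← nsmul_eq_mul]
    refine (Finset.card_nsmul_le_sum _ f t fun b hb => ?_).trans
      (Finset.sum_le_univ_sum_of_nonneg hf)
    exact (not_le.1 (Finset.mem_filter.1 hb).2).le
  have h2 : 2 * ((Finset.univ.filter fun b => ¬ f b ≤ t).card : ℝ) ≤ Fintype.card β := by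
    have := hbad.trans hsum
    refine le_of_mul_le_mul_right ?_ ht
    linarith
  have h3 : 2 * (Finset.univ.filter fun b => ¬ f b ≤ t).card ≤ Fintype.card β := by
    exact_mod_cast h2
  rw [Finset.card_univ] at hsplit
  omega

/-- Disjoint groups of `g` messages `a` each, such that the mean of `e` over every group is small
for every `b` in a set `B` of at least half of the messages of the other sender. If `s` exceeds
`M`, as for a sender with a single message, the only group consists of all messages. -/
theorem exists_grouping {M N s : ℕ} (hM : 1 ≤ M) (hs : 1 ≤ s) (e : Fin M → Fin N → ℝ)
    (he₀ : ∀ a b, 0 ≤ e a b) (he₁ : ∀ a b, e a b ≤ 1) {ε : ℝ} (hε : 0 < ε)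
    (havg : ∑ a, ∑ b, e a b ≤ ε * (M * N))
    (hMN : M * N * Real.exp (-(4 * ε * s)) < 1) :
    ∃ (L g : ℕ) (G : Fin L → Finset (Fin M)) (B : Finset (Fin N)),
      1 ≤ L ∧ 1 ≤ g ∧ M ≤ 2 * s * L ∧ N ≤ 2 * B.card ∧ (∀ l, (G l).card = g) ∧
      (∀ l l', l ≠ l' → Disjoint (G l) (G l')) ∧
      ∀ l, ∀ b ∈ B, ∑ a ∈ G l, e a b ≤ 12 * ε * g := by
  classical
  have hM' : (0 : ℝ) < M := by exact_mod_cast hM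
  rcases lt_or_ge M s with hlt | hle
  · refine ⟨1, M, fun _ => Finset.univ, Finset.univ.filter fun b => ∑ a, e a b ≤ 4 * ε * M,
      le_rfl, hM, by omega, ?_, by simp, fun l l' h => (h (Subsingleton.elim _ _)).elim, ?_⟩
    · have := card_le_two_mul_card_filter_le (fun b => ∑ a, e a b)
        (fun b => Finset.sum_nonneg fun a _ => he₀ a b) (t := 4 * ε * M) (by positivity)
        (by
          rw [Finset.sum_comm, Fintype.card_fin]
          have : 0 ≤ ε * (M * N) := by positivity
          nlinarith)
      simpa using this
    · intro l b hb
      have := (Finset.mem_filter.1 hb).2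
      have h0 : 0 ≤ ε * M := by positivity
      nlinarith
  · set L := M / s with hLdef
    have hL : 1 ≤ L := (Nat.one_le_div_iff (by omega)).2 hle
    have hsL : s * L ≤ M := Nat.mul_div_le M s
    have hM2 : M ≤ 2 * s * L := by
      have h := Nat.lt_mul_div_succ M (show 0 < s by omega)
      rw [← hLdef] at h
      nlinarith
    have : NeZero L := ⟨by omega⟩
    obtain ⟨φ⟩ : Nonempty (Fin s × Fin L ↪ Fin M) :=
      Function.Embedding.nonempty_of_card_le (by simpa using hsL)
    have hs' : (0 : ℝ) < s := by exact_mod_cast hs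
    have hL' : (0 : ℝ) < L := by exact_mod_cast hL
    set B : Finset (Fin N) :=
      Finset.univ.filter fun b => ∑ j, ∑ x, e (φ (j, x)) b ≤ 4 * ε * (s * L) with hB
    have hBcard : N ≤ 2 * B.card := by
      have := card_le_two_mul_card_filter_le (fun b => ∑ j, ∑ x, e (φ (j, x)) b)
        (fun b => Finset.sum_nonneg fun _ _ => Finset.sum_nonneg fun _ _ => he₀ _ b)
        (t := 4 * ε * (s * L)) (by positivity)
        (by
          have h1 : ∀ b, ∑ j, ∑ x, e (φ (j, x)) b ≤ ∑ a, e a b := by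
            intro b
            rw [← Fintype.sum_prod_type' (f := fun j x => e (φ (j, x)) b)]
            rw [← Finset.sum_map Finset.univ φ fun a => e a b]
            exact Finset.sum_le_univ_sum_of_nonneg fun a => he₀ a b
          have h2 : (M : ℝ) ≤ 2 * s * L := by exact_mod_cast hM2
          calc ∑ b, ∑ j, ∑ x, e (φ (j, x)) b ≤ ∑ b, ∑ a, e a b :=
                Finset.sum_le_sum fun b _ => h1 b
            _ = ∑ a, ∑ b, e a b := Finset.sum_comm
            _ ≤ ε * (M * N) := havg
            _ ≤ ε * ((2 * s * L) * N) := by gcongr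
            _ = _ := by rw [Fintype.card_fin]; ring)
      simpa using this
    obtain ⟨r, hr⟩ := exists_shift B (fun j x b => e (φ (j, x)) b) (fun _ _ _ => he₀ _ _)
      (fun _ _ _ => he₁ _ _) (μ := 4 * ε) (fun b hb => (Finset.mem_filter.1 hb).2) (by
        refine lt_of_le_of_lt ?_ hMN
        have h1 : (L : ℝ) ≤ M := by exact_mod_cast Nat.div_le_self M s
        have h2 : (B.card : ℝ) ≤ N := by
          exact_mod_cast (Finset.card_le_univ B).trans_eq (Fintype.card_fin N)
        gcongr)
    -- the `l`-th group contains one element of every column `j`, displaced by the shift `r j`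
    let ψ : Fin L → Fin s ↪ Fin M := fun l =>
      ⟨fun j => φ (j, l + r j), fun j j' h => (Prod.ext_iff.1 (φ.injective h)).1⟩
    refine ⟨L, s, fun l => Finset.univ.map (ψ l), B, hL, hs, hM2, hBcard, by simp, ?_, ?_⟩
    · intro l l' hll
      rw [Finset.disjoint_left]
      intro a ha ha'
      obtain ⟨j, -, rfl⟩ := Finset.mem_map.1 ha
      obtain ⟨j', -, h⟩ := Finset.mem_map.1 ha'
      have h := Prod.ext_iff.1 (φ.injective h)
      obtain rfl : j' = j := h.1
      exact hll (add_right_cancel h.2).symm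
    · intro l b hb
      rw [Finset.sum_map]
      refine (hr l b hb).trans (le_of_eq (by ring))

/-! ### Set families with small intersections -/

/-- The Gilbert bound: over an alphabet of size `4 ^ r` there are `2 ^ w` words of length `w` which
pairwise agree in fewer than `w / r` places. -/
theorem exists_code_small_agreement (w : ℕ) {r : ℕ} (hr : 1 ≤ r) :
    ∃ c : Fin (2 ^ w) → Fin w → Fin (4 ^ r), ∀ m m', m ≠ m' →
      r * (Finset.univ.filter fun i => c m i = c m' i).card < w := by
  classical
  set q := 4 ^ r with hq
  have hq0 : 1 ≤ q := Nat.one_le_pow _ _ (by norm_num)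
  let agr : (Fin w → Fin q) → (Fin w → Fin q) → ℕ := fun f g =>
    (Finset.univ.filter fun i => f i = g i).card
  have hball : ∀ f : Fin w → Fin q,
      (Finset.univ.filter fun g => w ≤ r * agr f g).card * 2 ^ w ≤ q ^ w := by
    intro f
    -- Markov's inequality for the weight `q ^ agr f g`, which is at least `4 ^ w` on the ball
    have h1 : (Finset.univ.filter fun g => w ≤ r * agr f g).card * 4 ^ w ≤
        ∑ g : Fin w → Fin q, ∏ i, (if f i = g i then q else 1) := by
      rw [← smul_eq_mul]
      refine (Finset.card_nsmul_le_sum _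
        (fun g : Fin w → Fin q => ∏ i, (if f i = g i then q else 1)) _ fun g hg => ?_).trans
        (Finset.sum_le_univ_sum_of_nonneg fun _ => Nat.zero_le _)
      have hg := (Finset.mem_filter.1 hg).2
      have h : ∏ i, (if f i = g i then q else 1) = q ^ agr f g := by simp [Finset.prod_ite, agr]
      rw [h]
      calc 4 ^ w ≤ 4 ^ (r * agr f g) := Nat.pow_le_pow_right (by norm_num) hg
        _ = q ^ agr f g := pow_mul ..
    have h2 : ∑ g : Fin w → Fin q, ∏ i, (if f i = g i then q else 1) ≤ (2 * q) ^ w := by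
      have := Finset.prod_univ_sum (fun _ : Fin w => (Finset.univ : Finset (Fin q)))
        (fun i x => if f i = x then q else 1)
      rw [Fintype.piFinset_univ] at this
      rw [← this]
      calc ∏ i : Fin w, ∑ x : Fin q, (if f i = x then q else 1)
          ≤ ∏ i : Fin w, (2 * q) := by
            refine Finset.prod_le_prod' fun i _ => ?_
            calc ∑ x : Fin q, (if f i = x then q else 1)
                ≤ ∑ x : Fin q, ((if f i = x then q else 0) + 1) :=
                  Finset.sum_le_sum fun x _ => by split_ifs <;> omega
              _ = 2 * q := by
                  rw [Finset.sum_add_distrib, Finset.sum_ite_eq]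
                  simp; omega
        _ = (2 * q) ^ w := by simp
    have h3 := h1.trans h2
    have h4 : (4 : ℕ) ^ w = 2 ^ w * 2 ^ w := mul_pow 2 2 w
    rw [h4, mul_pow, ← mul_assoc, mul_comm (2 ^ w) (q ^ w)] at h3
    exact Nat.le_of_mul_le_mul_right h3 (by positivity)
  -- a code of maximal size: the balls around its words cover the whole space
  obtain ⟨C, hC, hmax⟩ := Finset.exists_max_image
    (Finset.univ.filter fun C : Finset (Fin w → Fin q) =>
      ∀ f ∈ C, ∀ g ∈ C, f ≠ g → r * agr f g < w) Finset.card ⟨∅, by simp⟩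
  have hC := (Finset.mem_filter.1 hC).2
  have hsymm : ∀ f g, agr f g = agr g f := fun f g => by simp only [agr, eq_comm]
  have hcover : (Finset.univ : Finset (Fin w → Fin q)) ⊆
      C.biUnion fun f => Finset.univ.filter fun g => w ≤ r * agr f g := by
    intro g _
    by_contra hg
    simp only [Finset.mem_biUnion, Finset.mem_filter, Finset.mem_univ,
      true_and, not_exists, not_and, not_le] at hg
    have hgC : g ∉ C := fun hgC => by
      have h := hg g hgC
      have h' : agr g g = w := by simp [agr]
      rw [h'] at h
      nlinarith
    have := hmax (insert g C) (Finset.mem_filter.2 ⟨Finset.mem_univ _, by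
      intro f hf f' hf' hne
      rcases Finset.mem_insert.1 hf with rfl | hfC
      · rcases Finset.mem_insert.1 hf' with rfl | hfC'
        · exact (hne rfl).elim
        · rw [hsymm]; exact hg _ hfC'
      · rcases Finset.mem_insert.1 hf' with rfl | hfC'
        · exact hg _ hfC
        · exact hC _ hfC _ hfC' hne⟩)
    rw [Finset.card_insert_of_notMem hgC] at this
    omega
  have hcard : 2 ^ w ≤ C.card := by
    have h1 : q ^ w ≤ ∑ f ∈ C, (Finset.univ.filter fun g => w ≤ r * agr f g).card := by
      simpa using (Finset.card_le_card hcover).trans Finset.card_biUnion_le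
    have h2 : q ^ w * 2 ^ w ≤ C.card * q ^ w := by
      calc q ^ w * 2 ^ w
          ≤ (∑ f ∈ C, (Finset.univ.filter fun g => w ≤ r * agr f g).card) * 2 ^ w :=
            Nat.mul_le_mul_right _ h1
        _ ≤ ∑ f ∈ C, q ^ w := by
            rw [Finset.sum_mul]
            exact Finset.sum_le_sum fun f _ => hball f
        _ = C.card * q ^ w := by simp
    rw [mul_comm] at h2
    exact Nat.le_of_mul_le_mul_right h2 (Nat.pow_pos hq0)
  obtain ⟨c⟩ : Nonempty (Fin (2 ^ w) ↪ C) :=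
    Function.Embedding.nonempty_of_card_le (by simpa using hcard)
  exact ⟨fun m => c m, fun m m' hne =>
    hC _ (c m).2 _ (c m').2 fun h => hne (c.injective (Subtype.ext h))⟩

/-- A doubly exponential family of sets, up to a constant in the exponent. Its size is `1` if `n` is
too small for a block of `4 ^ r` elements; the bound on `logLog M` is then trivial. -/
theorem exists_set_family {n r : ℕ} (hn : 1 ≤ n) (hr : 1 ≤ r) :
    ∃ (M : ℕ) (U : Fin M → Finset (Fin n)), 1 ≤ M ∧ (∀ m, (U m).Nonempty) ∧
      (∀ m m', m ≠ m' → r * (U m ∩ U m').card ≤ (U m).card) ∧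
      Real.logb 2 n - Real.logb 2 (2 * 4 ^ r) ≤ logLog M := by
  classical
  have hn' : (0 : ℝ) < n := by exact_mod_cast hn
  set q := 4 ^ r with hq
  have hq0 : 0 < q := by positivity
  have hqR : (0 : ℝ) < 2 * 4 ^ r := by positivity
  rw [← Real.logb_div hn'.ne' hqR.ne']
  set w := n / q with hwdef
  have hwq : w * q ≤ n := Nat.div_mul_le_self n q
  have hwn : n < q * (w + 1) := Nat.lt_mul_div_succ n hq0
  rcases Nat.eq_zero_or_pos w with hw | hw
  · refine ⟨1, fun _ => {⟨0, hn⟩}, le_rfl, fun _ => by simp,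
      fun m m' h => (h (Subsingleton.elim _ _)).elim, ?_⟩
    rw [logLog, if_pos le_rfl]
    refine Real.logb_nonpos (by norm_num) (by positivity) ?_
    rw [div_le_one hqR]
    have : n ≤ 2 * 4 ^ r := by rw [hw] at hwn; omega
    exact_mod_cast this
  · obtain ⟨c, hc⟩ := exists_code_small_agreement w hr
    obtain ⟨φ⟩ : Nonempty (Fin w × Fin q ↪ Fin n) :=
      Function.Embedding.nonempty_of_card_le (by simpa using hwq)
    -- a word is turned into a set by passing to its graph
    let ψ : Fin (2 ^ w) → Fin w ↪ Fin n := fun m =>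
      ⟨fun i => φ (i, c m i), fun i i' h => (Prod.ext_iff.1 (φ.injective h)).1⟩
    refine ⟨2 ^ w, fun m => Finset.univ.map (ψ m), Nat.one_le_two_pow, fun m => ?_, ?_, ?_⟩
    · rw [← Finset.card_pos]; simpa using hw
    · intro m m' hne
      have hsub : Finset.univ.map (ψ m) ∩ Finset.univ.map (ψ m') ⊆
          (Finset.univ.filter fun i => c m i = c m' i).map (ψ m) := by
        intro a ha
        obtain ⟨ha, ha'⟩ := Finset.mem_inter.1 ha
        obtain ⟨i, -, rfl⟩ := Finset.mem_map.1 ha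
        obtain ⟨i', -, h⟩ := Finset.mem_map.1 ha'
        have h := Prod.ext_iff.1 (φ.injective h)
        obtain rfl : i' = i := h.1
        exact Finset.mem_map_of_mem _ (Finset.mem_filter.2 ⟨Finset.mem_univ _, h.2.symm⟩)
      have h1 := Finset.card_le_card hsub
      rw [Finset.card_map] at h1
      have h2 := hc m m' hne
      rw [Finset.card_map, Finset.card_univ, Fintype.card_fin]
      nlinarith
    · have h2 : ¬ 2 ^ w ≤ 1 := by
        have := Nat.one_lt_two_pow (n := w) (by omega)
        omega
      rw [logLog, if_neg h2]
      push_cast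
      rw [Real.logb_pow, Real.logb_self_eq_one (by norm_num), mul_one]
      refine Real.logb_le_logb_of_le (by norm_num) (by positivity) ?_
      rw [div_le_iff₀ hqR]
      have : n ≤ w * (2 * 4 ^ r) := by nlinarith
      exact_mod_cast this

/-- Families of sets of messages for both senders, of nearly the doubly exponential size, with small
overlaps and small mean error on all products. For the first sender the sets are unions of groups;
for the second one they consist of good messages. -/
theorem exists_id_families {M N s r : ℕ} (hM : 1 ≤ M) (hN : 1 ≤ N) (hs : 1 ≤ s) (hr : 1 ≤ r)
    (e : Fin M → Fin N → ℝ) (he₀ : ∀ a b, 0 ≤ e a b) (he₁ : ∀ a b, e a b ≤ 1)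
    {ε : ℝ} (hε : 0 < ε) (havg : ∑ a, ∑ b, e a b ≤ ε * (M * N))
    (hMN : M * N * Real.exp (-(4 * ε * s)) < 1) :
    ∃ (M₁ N₁ : ℕ) (U : Fin M₁ → Finset (Fin M)) (V : Fin N₁ → Finset (Fin N)),
      1 ≤ M₁ ∧ 1 ≤ N₁ ∧ (∀ m, (U m).Nonempty) ∧ (∀ n, (V n).Nonempty) ∧
      (∀ m m', m ≠ m' → r * (U m ∩ U m').card ≤ (U m).card) ∧
      (∀ n n', n ≠ n' → r * (V n ∩ V n').card ≤ (V n).card) ∧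
      (∀ m n, ∑ a ∈ U m, ∑ b ∈ V n, e a b ≤ 12 * ε * ((U m).card * (V n).card)) ∧
      Real.logb 2 M - Real.logb 2 (4 ^ (r + 1) * s) ≤ logLog M₁ ∧
      Real.logb 2 N - Real.logb 2 (4 ^ (r + 1) * s) ≤ logLog N₁ := by
  classical
  obtain ⟨L, g, G, B, hL, hg, hML, hNB, hGcard, hGdisj, hGe⟩ :=
    exists_grouping hM hs e he₀ he₁ hε havg hMN
  have hB : 1 ≤ B.card := by omega
  obtain ⟨M₁, A, hM₁, hAne, hA, hlogM⟩ := exists_set_family hL hr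
  obtain ⟨N₁, A', hN₁, hAne', hA', hlogN⟩ := exists_set_family hB hr
  let φ : Fin B.card ↪ Fin N := (B.orderEmbOfFin rfl).toEmbedding
  have hφ : ∀ i, φ i ∈ B := fun i => B.orderEmbOfFin_mem rfl i
  have hs0 : (0 : ℝ) < s := by exact_mod_cast hs
  have hM0 : (0 : ℝ) < M := by exact_mod_cast hM
  have hN0 : (0 : ℝ) < N := by exact_mod_cast hN
  have hL0 : (0 : ℝ) < L := by exact_mod_cast hL
  have hB0 : (0 : ℝ) < B.card := by exact_mod_cast hB
  have hdisj : ∀ S : Finset (Fin L), (S : Set (Fin L)).PairwiseDisjoint G :=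
    fun S l _ l' _ h => hGdisj l l' h
  have hcard : ∀ S : Finset (Fin L), (S.biUnion G).card = S.card * g := by
    intro S
    rw [Finset.card_biUnion fun l _ l' _ h => hGdisj l l' h]
    simp [hGcard]
  refine ⟨M₁, N₁, fun m => (A m).biUnion G, fun n => (A' n).map φ, hM₁, hN₁, ?_, ?_, ?_, ?_, ?_,
    ?_, ?_⟩
  · intro m
    rw [← Finset.card_pos, hcard]
    exact Nat.mul_pos (Finset.card_pos.2 (hAne m)) hg
  · intro n
    simpa using hAne' n
  · intro m m' hne
    have hinter : (A m).biUnion G ∩ (A m').biUnion G ⊆ (A m ∩ A m').biUnion G := by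
      intro a ha
      obtain ⟨ha, ha'⟩ := Finset.mem_inter.1 ha
      obtain ⟨l, hl, hal⟩ := Finset.mem_biUnion.1 ha
      obtain ⟨l', hl', hal'⟩ := Finset.mem_biUnion.1 ha'
      obtain rfl : l = l' := by
        by_contra h
        exact Finset.disjoint_left.1 (hGdisj l l' h) hal hal'
      exact Finset.mem_biUnion.2 ⟨l, Finset.mem_inter.2 ⟨hl, hl'⟩, hal⟩
    have h := Finset.card_le_card hinter
    rw [hcard] at h
    rw [hcard]
    calc r * ((A m).biUnion G ∩ (A m').biUnion G).card ≤ r * ((A m ∩ A m').card * g) :=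
          Nat.mul_le_mul_left _ h
      _ = r * (A m ∩ A m').card * g := by ring
      _ ≤ _ := Nat.mul_le_mul_right _ (hA m m' hne)
  · intro n n' hne
    rw [← Finset.map_inter, Finset.card_map, Finset.card_map]
    exact hA' n n' hne
  · intro m n
    rw [Finset.sum_comm, Finset.sum_map, hcard, Finset.card_map]
    calc ∑ i ∈ A' n, ∑ a ∈ (A m).biUnion G, e a (φ i)
        = ∑ i ∈ A' n, ∑ l ∈ A m, ∑ a ∈ G l, e a (φ i) :=
          Finset.sum_congr rfl fun i _ => Finset.sum_biUnion (hdisj _)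
      _ ≤ ∑ i ∈ A' n, ∑ l ∈ A m, 12 * ε * g :=
          Finset.sum_le_sum fun i _ => Finset.sum_le_sum fun l _ => hGe l _ (hφ i)
      _ = _ := by
          simp only [Finset.sum_const, nsmul_eq_mul]
          push_cast
          ring
  · refine le_trans ?_ hlogM
    rw [← Real.logb_div hM0.ne' (by positivity), ← Real.logb_div hL0.ne' (by positivity)]
    refine Real.logb_le_logb_of_le (by norm_num) (by positivity) ?_
    rw [div_le_div_iff₀ (by positivity) (by positivity)]
    have : (M : ℝ) ≤ 2 * s * L := by exact_mod_cast hML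
    calc (M : ℝ) * (2 * 4 ^ r) ≤ 2 * s * L * (2 * 4 ^ r) := by gcongr
      _ = _ := by ring
  · refine le_trans ?_ hlogN
    rw [← Real.logb_div hN0.ne' (by positivity), ← Real.logb_div hB0.ne' (by positivity)]
    refine Real.logb_le_logb_of_le (by norm_num) (by positivity) ?_
    rw [div_le_div_iff₀ (by positivity) (by positivity)]
    have : (N : ℝ) ≤ 2 * B.card := by exact_mod_cast hNB
    have hs1 : (1 : ℝ) ≤ s := by exact_mod_cast hs
    calc (N : ℝ) * (2 * 4 ^ r) ≤ 2 * B.card * (2 * 4 ^ r) * 1 := by rw [mul_one]; gcongr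
      _ ≤ 2 * B.card * (2 * 4 ^ r) * s := by gcongr
      _ = _ := by ring

/-! ### Probabilities of effects -/

section Prob

variable {n : Type*} [Fintype n]

open scoped MatrixOrder Matrix.Norms.L2Operator in
theorem _root_.Matrix.PosSemidef.exists_eq_conjTranspose_mul_self {A : Matrix n n ℂ}
    (hA : A.PosSemidef) : ∃ B : Matrix n n ℂ, A = Bᴴ * B := by
  classical
  exact CStarAlgebra.nonneg_iff_eq_star_mul_self.mp hA.nonneg

theorem prob_nonneg {E : Matrix n n ℂ} (hE : E.PosSemidef) (ρ : State n) : 0 ≤ prob E ρ := by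
  classical
  obtain ⟨B, rfl⟩ := hE.exists_eq_conjTranspose_mul_self
  have h := (ρ.posSemidef.mul_mul_conjTranspose_same B).trace_nonneg
  rw [Matrix.trace_mul_comm, ← Matrix.mul_assoc] at h
  exact (Complex.nonneg_iff.1 h).1

theorem prob_sum {α : Type*} (S : Finset α) (E : α → Matrix n n ℂ) (ρ : State n) :
    prob (∑ a ∈ S, E a) ρ = ∑ a ∈ S, prob (E a) ρ := by
  simp [prob, Finset.sum_mul, Matrix.trace_sum]

theorem prob_one [DecidableEq n] (ρ : State n) : prob 1 ρ = 1 := by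
  simp [prob, ρ.trace_eq_one]

open scoped Matrix.Norms.Frobenius in
theorem re_trace_conjTranspose_mul_self (A : Matrix n n ℂ) : (Aᴴ * A).trace.re = ‖A‖ ^ 2 := by
  rw [Matrix.frobenius_norm_def, ← Real.sqrt_eq_rpow, Real.sq_sqrt (by positivity),
    Finset.sum_comm]
  simp only [Matrix.trace, Matrix.diag_apply, Matrix.mul_apply, Matrix.conjTranspose_apply,
    Complex.re_sum]
  refine Finset.sum_congr rfl fun i _ => Finset.sum_congr rfl fun j _ => ?_
  rw [Complex.star_def, Complex.conj_mul']
  norm_cast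

open scoped Matrix.Norms.Frobenius in
theorem prob_le_trace {E : Matrix n n ℂ} (hE : E.PosSemidef) (ρ : State n) :
    prob E ρ ≤ E.trace.re := by
  classical
  obtain ⟨B, rfl⟩ := hE.exists_eq_conjTranspose_mul_self
  obtain ⟨C, hC⟩ := ρ.posSemidef.exists_eq_conjTranspose_mul_self
  have hC1 : ‖C‖ ^ 2 = 1 := by
    rw [← re_trace_conjTranspose_mul_self, ← hC, ρ.trace_eq_one, Complex.one_re]
  have h : prob (Bᴴ * B) ρ = ‖C * Bᴴ‖ ^ 2 := by
    rw [← re_trace_conjTranspose_mul_self, prob, hC, Matrix.conjTranspose_mul,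
      Matrix.conjTranspose_conjTranspose, Matrix.mul_assoc, Matrix.trace_mul_comm]
    simp only [Matrix.mul_assoc]
  have hB : ‖Bᴴ‖ = ‖B‖ := Matrix.frobenius_norm_conjTranspose B
  rw [h, re_trace_conjTranspose_mul_self]
  calc ‖C * Bᴴ‖ ^ 2 ≤ (‖C‖ * ‖Bᴴ‖) ^ 2 := by gcongr; exact Matrix.frobenius_norm_mul _ _
    _ = ‖B‖ ^ 2 := by rw [mul_pow, hC1, hB, one_mul]

end Prob

/-! ### Errors and size of a transmission code -/

section Code

variable {X Y ι : Type*} [Fintype ι] [DecidableEq ι] {k M N : ℕ}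

/-- The probability that the decoder of the code `c` does not find the pair `(m, n)` if it was
sent over `W^k`. -/
noncomputable def Code.pairError (c : Code X Y ι k M N) (W : Channel X Y ι)
    (m : Fin M) (n : Fin N) : ℝ :=
  1 - prob (c.D m n) (W k (c.x m) (c.y n))

theorem Code.sum_prob (c : Code X Y ι k M N) (ρ : State (Fin k → ι)) :
    ∑ p : Fin M × Fin N, prob (c.D p.1 p.2) ρ = 1 := by
  rw [← prob_sum, Fintype.sum_prod_type, c.sum_D, prob_one]

theorem Code.prob_le_one (c : Code X Y ι k M N) (ρ : State (Fin k → ι)) (m : Fin M) (n : Fin N) :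
    prob (c.D m n) ρ ≤ 1 := by
  have hnn : ∀ p ∈ Finset.univ, 0 ≤ (fun p : Fin M × Fin N => prob (c.D p.1 p.2) ρ) p :=
    fun p _ => prob_nonneg (c.D_posSemidef p.1 p.2) ρ
  exact (Finset.single_le_sum hnn (Finset.mem_univ (m, n))).trans_eq (c.sum_prob ρ)

theorem Code.pairError_nonneg (c : Code X Y ι k M N) (W : Channel X Y ι) (m : Fin M)
    (n : Fin N) : 0 ≤ c.pairError W m n :=
  sub_nonneg.2 (c.prob_le_one _ m n)

theorem Code.pairError_le_one (c : Code X Y ι k M N) (W : Channel X Y ι) (m : Fin M)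
    (n : Fin N) : c.pairError W m n ≤ 1 :=
  sub_le_self _ (prob_nonneg (c.D_posSemidef _ _) _)

theorem Code.sum_pairError (c : Code X Y ι k M N) (W : Channel X Y ι) (hM : 1 ≤ M)
    (hN : 1 ≤ N) : ∑ m, ∑ n, c.pairError W m n = c.avgError W * (M * N) := by
  have hM0 : (0 : ℝ) < M := by exact_mod_cast hM
  have hN0 : (0 : ℝ) < N := by exact_mod_cast hN
  simp only [Code.pairError, Code.avgError, Finset.sum_sub_distrib]
  simp only [Finset.sum_const, Finset.card_univ, Fintype.card_fin, nsmul_eq_mul, mul_one]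
  field_simp

/-- A weak converse: the success probability of a pair is at most the trace of its decoding
operator, and these traces add up to the dimension. -/
theorem Code.card_mul_card_le (c : Code X Y ι k M N) (W : Channel X Y ι) (hM : 1 ≤ M)
    (hN : 1 ≤ N) (herr : c.avgError W ≤ 1 / 2) :
    (M * N : ℝ) ≤ 2 * (Fintype.card ι : ℝ) ^ k := by
  have h1 : ∑ m, ∑ n, prob (c.D m n) (W k (c.x m) (c.y n)) ≤ (Fintype.card ι : ℝ) ^ k := by
    calc ∑ m, ∑ n, prob (c.D m n) (W k (c.x m) (c.y n))
        ≤ ∑ m, ∑ n, (c.D m n).trace.re := Finset.sum_le_sum fun m _ => Finset.sum_le_sum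
          fun n _ => prob_le_trace (c.D_posSemidef m n) _
      _ = (∑ m, ∑ n, c.D m n).trace.re := by simp [Matrix.trace_sum]
      _ = _ := by rw [c.sum_D, Matrix.trace_one, Complex.natCast_re]; simp
  have h2 := c.sum_pairError W hM hN
  have h3 : c.avgError W * (M * N) ≤ 1 / 2 * (M * N) := by gcongr
  simp only [Code.pairError, Finset.sum_sub_distrib] at h2
  simp only [Finset.sum_const, Finset.card_univ, Fintype.card_fin, nsmul_eq_mul, mul_one] at h2
  linarith

end Code

/-! ### From transmission codes to identification codes -/

section Uniform

variable {α β : Type*}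

open Classical in
/-- The distribution of `x a` if `a` is uniformly distributed on the finite set `U`. -/
noncomputable def uniformImage (U : Finset α) (x : α → β) (z : β) : ℝ :=
  (∑ a ∈ U, if x a = z then 1 else 0) / U.card

theorem sum_uniformImage_mul [Fintype β] (U : Finset α) (x : α → β) (F : β → ℝ) :
    ∑ z, uniformImage U x z * F z = (∑ a ∈ U, F (x a)) / U.card := by
  classical
  simp only [uniformImage, div_mul_eq_mul_div, ← Finset.sum_div, Finset.sum_mul]
  rw [Finset.sum_comm]
  simp

theorem uniformImage_mem_stdSimplex [Fintype β] {U : Finset α} (hU : U.Nonempty) (x : α → β) :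
    uniformImage U x ∈ stdSimplex ℝ β := by
  classical
  refine ⟨fun z => div_nonneg (Finset.sum_nonneg fun a _ => by split_ifs <;> simp) (by simp), ?_⟩
  have h := sum_uniformImage_mul U x fun _ => 1
  simp only [mul_one, Finset.sum_const, nsmul_eq_mul] at h
  rw [h, div_self]
  exact_mod_cast hU.card_pos.ne'

end Uniform

section IDCode

variable {X Y ι : Type*} [Fintype X] [Fintype Y] [Fintype ι] [DecidableEq ι] {k M N M₁ N₁ : ℕ}

/-- The identification code which sends `(m, n)` as a uniformly distributed pair of codewords of `c`
with messages in `U m ×ˢ V n`, and whose test for `(m, n)` is whether the decoder of `c` outputs a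
pair in `U m ×ˢ V n`. -/
noncomputable def Code.toIDCode (c : Code X Y ι k M N) {U : Fin M₁ → Finset (Fin M)}
    {V : Fin N₁ → Finset (Fin N)} (hU : ∀ m, (U m).Nonempty) (hV : ∀ n, (V n).Nonempty) :
    IDCode X Y ι k M₁ N₁ where
  P m := uniformImage (U m) c.x
  P_mem m := uniformImage_mem_stdSimplex (hU m) _
  Q n := uniformImage (V n) c.y
  Q_mem n := uniformImage_mem_stdSimplex (hV n) _
  I m n := ∑ p ∈ U m ×ˢ V n, c.D p.1 p.2
  I_nonneg m n := Matrix.posSemidef_sum _ fun p _ => c.D_posSemidef _ _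
  I_le_one m n := by
    have h : (1 : Matrix (Fin k → ι) (Fin k → ι) ℂ) - ∑ p ∈ U m ×ˢ V n, c.D p.1 p.2 =
        ∑ p ∈ (U m ×ˢ V n)ᶜ, c.D p.1 p.2 := by
      rw [sub_eq_iff_eq_add, Finset.sum_compl_add_sum, Fintype.sum_prod_type, c.sum_D]
    rw [h]
    exact Matrix.posSemidef_sum _ fun p _ => c.D_posSemidef _ _

variable (c : Code X Y ι k M N) (W : Channel X Y ι) {U : Fin M₁ → Finset (Fin M)}
    {V : Fin N₁ → Finset (Fin N)} (hU : ∀ m, (U m).Nonempty) (hV : ∀ n, (V n).Nonempty)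

theorem Code.acceptProb_toIDCode (s t : Fin M₁ × Fin N₁) :
    (c.toIDCode hU hV).acceptProb W s t =
      (∑ p ∈ U s.1 ×ˢ V s.2, ∑ p' ∈ U t.1 ×ˢ V t.2,
        prob (c.D p'.1 p'.2) (W k (c.x p.1) (c.y p.2))) / ((U s.1).card * (V s.2).card) := by
  simp only [IDCode.acceptProb, Code.toIDCode, mul_assoc, ← Finset.mul_sum, sum_uniformImage_mul,
    prob_sum]
  rw [← Finset.sum_div, div_div, Finset.sum_product' (f := fun a b => ∑ p' ∈ U t.1 ×ˢ V t.2,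
        prob (c.D p'.1 p'.2) (W k (c.x a) (c.y b))), mul_comm ((V s.2).card : ℝ)]

variable {η : ℝ} (hη : ∀ m n, ∑ a ∈ U m, ∑ b ∈ V n, c.pairError W a b ≤
  η * ((U m).card * (V n).card)) (hη₀ : 0 ≤ η)

include hη hη₀

theorem Code.error₁_toIDCode_le : (c.toIDCode hU hV).error₁ W ≤ η := by
  refine Real.iSup_le (fun s => ?_) hη₀
  have hpos : (0 : ℝ) < (U s.1).card * (V s.2).card := by
    exact_mod_cast Nat.mul_pos (hU s.1).card_pos (hV s.2).card_pos
  rw [c.acceptProb_toIDCode W, sub_le_comm, le_div_iff₀ hpos]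
  have h := hη s.1 s.2
  rw [← Finset.sum_product' (f := fun a b => c.pairError W a b)] at h
  simp only [Code.pairError, Finset.sum_sub_distrib] at h
  simp only [Finset.sum_const, Finset.card_product, nsmul_eq_mul, mul_one, Nat.cast_mul] at h
  have h2 : ∑ p ∈ U s.1 ×ˢ V s.2, prob (c.D p.1 p.2) (W k (c.x p.1) (c.y p.2)) ≤
      ∑ p ∈ U s.1 ×ˢ V s.2, ∑ p' ∈ U s.1 ×ˢ V s.2,
        prob (c.D p'.1 p'.2) (W k (c.x p.1) (c.y p.2)) :=
    Finset.sum_le_sum fun p hp => by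
      have hnn : ∀ p' ∈ U s.1 ×ˢ V s.2, 0 ≤ (fun p' : Fin M × Fin N =>
          prob (c.D p'.1 p'.2) (W k (c.x p.1) (c.y p.2))) p' :=
        fun p' _ => prob_nonneg (c.D_posSemidef p'.1 p'.2) _
      exact Finset.single_le_sum hnn hp
  linarith

theorem Code.error₂_toIDCode_le {r : ℕ} (hr : 1 ≤ r)
    (hUU : ∀ m m', m ≠ m' → r * (U m ∩ U m').card ≤ (U m).card)
    (hVV : ∀ n n', n ≠ n' → r * (V n ∩ V n').card ≤ (V n).card) :
    (c.toIDCode hU hV).error₂ W ≤ η + 1 / r := by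
  classical
  have hr0 : (0 : ℝ) < r := by exact_mod_cast hr
  refine Real.iSup_le (fun ⟨⟨s, t⟩, hst⟩ => ?_) (by positivity)
  have hpos : (0 : ℝ) < (U s.1).card * (V s.2).card := by
    exact_mod_cast Nat.mul_pos (hU s.1).card_pos (hV s.2).card_pos
  simp only
  rw [c.acceptProb_toIDCode W, div_le_iff₀ hpos]
  have hinter : r * ((U s.1 ×ˢ V s.2) ∩ (U t.1 ×ˢ V t.2)).card ≤ (U s.1).card * (V s.2).card := by
    rw [Finset.product_inter_product, Finset.card_product]
    by_cases h1 : s.1 = t.1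
    · have h2 : s.2 ≠ t.2 := fun h2 => hst (Prod.ext h1 h2)
      calc r * ((U s.1 ∩ U t.1).card * (V s.2 ∩ V t.2).card)
          = (U s.1 ∩ U t.1).card * (r * (V s.2 ∩ V t.2).card) := by ring
        _ ≤ _ := Nat.mul_le_mul (Finset.card_le_card Finset.inter_subset_left) (hVV _ _ h2)
    · calc r * ((U s.1 ∩ U t.1).card * (V s.2 ∩ V t.2).card)
          = r * (U s.1 ∩ U t.1).card * (V s.2 ∩ V t.2).card := by ring
        _ ≤ _ := Nat.mul_le_mul (hUU _ _ h1) (Finset.card_le_card Finset.inter_subset_left)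
  have hinter' : (((U s.1 ×ˢ V s.2) ∩ (U t.1 ×ˢ V t.2)).card : ℝ) ≤
      1 / r * ((U s.1).card * (V s.2).card) := by
    rw [one_div, inv_mul_eq_div, le_div_iff₀ hr0, mul_comm]
    exact_mod_cast hinter
  -- a pair outside the tested set is accepted only if it is decoded wrongly
  have hterm : ∀ p ∈ U s.1 ×ˢ V s.2, ∑ p' ∈ U t.1 ×ˢ V t.2,
      prob (c.D p'.1 p'.2) (W k (c.x p.1) (c.y p.2)) ≤
      c.pairError W p.1 p.2 + if p ∈ U t.1 ×ˢ V t.2 then 1 else 0 := by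
    intro p _
    set ρ := W k (c.x p.1) (c.y p.2)
    have hnn : ∀ p' : Fin M × Fin N, 0 ≤ prob (c.D p'.1 p'.2) ρ :=
      fun p' => prob_nonneg (c.D_posSemidef _ _) _
    split_ifs with hp
    · have h1 : ∑ p' ∈ U t.1 ×ˢ V t.2, prob (c.D p'.1 p'.2) ρ ≤ 1 := by
        rw [← c.sum_prob ρ]
        exact Finset.sum_le_univ_sum_of_nonneg hnn
      linarith [c.pairError_nonneg W p.1 p.2]
    · have h1 : ∑ p' ∈ insert p (U t.1 ×ˢ V t.2), prob (c.D p'.1 p'.2) ρ ≤ 1 := by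
        rw [← c.sum_prob ρ]
        exact Finset.sum_le_univ_sum_of_nonneg hnn
      rw [Finset.sum_insert hp] at h1
      rw [Code.pairError]
      linarith
  refine (Finset.sum_le_sum hterm).trans ?_
  rw [Finset.sum_add_distrib, Finset.sum_product' (f := fun a b => c.pairError W a b),
    Finset.sum_ite_mem]
  simp only [Finset.sum_const, nsmul_eq_mul, mul_one]
  rw [add_mul]
  exact add_le_add (hη s.1 s.2) hinter'

end IDCode

/-! ### Asymptotics -/

theorem eventually_logb_mul_le {K δ : ℝ} (hK : 0 < K) (hδ : 0 < δ) :
    ∀ᶠ k : ℕ in Filter.atTop, Real.logb 2 (K * k) ≤ δ * k := by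
  have hρ : 1 < (2 : ℝ) ^ δ := Real.one_lt_rpow (by norm_num) hδ
  have h := (tendsto_pow_const_div_const_pow_of_one_lt 1 hρ).eventually
    (ge_mem_nhds (show (0 : ℝ) < 1 / K by positivity))
  filter_upwards [h, Filter.eventually_ge_atTop 1] with k hk hk1
  have hk0 : (0 : ℝ) < k := by exact_mod_cast hk1
  rw [Real.logb_le_iff_le_rpow (by norm_num) (by positivity), Real.rpow_mul_natCast (by norm_num)]
  rw [pow_one, div_le_div_iff₀ (by positivity) hK] at hk
  linarith

/-- The `k`-th power of the left-hand side is less than `1` as well, so groups of size `C * k` are large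
enough for a union bound over `D ^ k` events of probability `Real.exp (-(c * C * k))` each. -/
theorem exists_nat_mul_exp_neg_lt_one (D : ℝ) {c : ℝ} (hc : 0 < c) :
    ∃ C : ℕ, 1 ≤ C ∧ D * Real.exp (-(c * C)) < 1 := by
  have h1 : Filter.Tendsto (fun C : ℕ => D * Real.exp (-(c * C))) Filter.atTop (nhds 0) := by
    rw [← mul_zero D]
    refine Filter.Tendsto.const_mul D (Real.tendsto_exp_neg_atTop_nhds_zero.comp ?_)
    exact tendsto_natCast_atTop_atTop.const_mul_atTop hc
  obtain ⟨C, hC, hC1⟩ :=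
    ((h1.eventually (gt_mem_nhds one_pos)).and (Filter.eventually_ge_atTop 1)).exists
  exact ⟨C, hC1, hC⟩

end CCQ

theorem mainTheorem5 {X Y ι : Type*} [Fintype X] [Fintype Y] [Fintype ι] [DecidableEq ι]
    (W : X → Y → CCQ.State ι) :
    CCQ.capacityRegion (CCQ.memoryless W) ⊆ CCQ.idCapacityRegion (CCQ.memoryless W) := by
  rintro ⟨R₁, R₂⟩ ⟨hR₁, hR₂, hach⟩
  refine ⟨hR₁, hR₂, fun ε₁ ε₂ δ hε₁ hε₂ hδ => ?_⟩
  obtain ⟨r, hr⟩ := exists_nat_gt (2 / ε₂)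
  have hr0 : (0 : ℝ) < r := (by positivity : 0 < 2 / ε₂).trans hr
  have hr1 : 1 ≤ r := by exact_mod_cast hr0
  have hrε : 1 / (r : ℝ) ≤ ε₂ / 2 := by
    rw [div_lt_iff₀ hε₂] at hr
    rw [div_le_div_iff₀ hr0 (by norm_num)]
    linarith
  -- `12 * ε` bounds the error of the grouped code; the remaining `ε₂ / 2` is left for overlaps
  set ε : ℝ := min (min ε₁ (ε₂ / 2)) 1 / 12 with hεdef
  have hε : 0 < ε := by positivity
  have hε12 : 12 * ε = min (min ε₁ (ε₂ / 2)) 1 := by rw [hεdef]; ring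
  have h12₁ : 12 * ε ≤ ε₁ := hε12 ▸ (min_le_left _ _).trans (min_le_left _ _)
  have h12₂ : 12 * ε ≤ ε₂ / 2 := hε12 ▸ (min_le_left _ _).trans (min_le_right _ _)
  have h12₃ : 12 * ε ≤ 1 := hε12 ▸ min_le_right _ _
  obtain ⟨C, hC1, hC⟩ := CCQ.exists_nat_mul_exp_neg_lt_one (2 * Fintype.card ι : ℝ)
    (show 0 < 4 * ε by positivity)
  have hC0 : (0 : ℝ) < C := by exact_mod_cast hC1
  obtain ⟨k₁, hk₁⟩ := hach ε (δ / 2) hε (by positivity)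
  obtain ⟨k₂, hk₂⟩ := Filter.eventually_atTop.1
    (CCQ.eventually_logb_mul_le (show (0 : ℝ) < 4 ^ (r + 1) * C by positivity)
      (show 0 < δ / 2 by positivity))
  refine ⟨max (max k₁ k₂) 1, fun k hk => ?_⟩
  have hk1 : 1 ≤ k := (le_max_right _ _).trans hk
  have hk0 : (0 : ℝ) < k := by exact_mod_cast hk1
  have hloss := hk₂ k (((le_max_right _ _).trans (le_max_left _ _)).trans hk)
  obtain ⟨M, N, hM, hN, c, hcM, hcN, herr⟩ :=
    hk₁ k (((le_max_left _ _).trans (le_max_left _ _)).trans hk)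
  have hMN : M * N * Real.exp (-(4 * ε * (C * k : ℕ))) < 1 := by
    have h1 := c.card_mul_card_le (CCQ.memoryless W) hM hN (herr.trans (by linarith))
    calc M * N * Real.exp (-(4 * ε * (C * k : ℕ)))
        ≤ 2 * (Fintype.card ι : ℝ) ^ k * Real.exp (-(4 * ε * (C * k : ℕ))) := by gcongr
      _ ≤ 2 ^ k * (Fintype.card ι : ℝ) ^ k * Real.exp (-(4 * ε * (C * k : ℕ))) := by
          gcongr
          exact le_self_pow₀ (by norm_num) (by omega)
      _ = (2 * Fintype.card ι * Real.exp (-(4 * ε * C))) ^ k := by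
          rw [mul_pow, mul_pow, ← Real.exp_nat_mul]
          congr 2
          push_cast
          ring
      _ < 1 := pow_lt_one₀ (by positivity) hC (by omega)
  have havg : ∑ a, ∑ b, c.pairError (CCQ.memoryless W) a b ≤ ε * (M * N) := by
    rw [c.sum_pairError _ hM hN]
    gcongr
  obtain ⟨M₁, N₁, U, V, hM₁, hN₁, hU, hV, hUU, hVV, hη, hlogM, hlogN⟩ :=
    CCQ.exists_id_families hM hN (Nat.mul_pos hC1 hk1) hr1 _ (c.pairError_nonneg _)
      (c.pairError_le_one _) hε havg hMN
  have hrate : ∀ {R a b : ℝ}, R - δ / 2 ≤ 1 / k * a →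
      a - Real.logb 2 (4 ^ (r + 1) * (C * k : ℕ)) ≤ b → R - δ ≤ 1 / k * b := by
    intro R a b ha hb
    rw [one_div, inv_mul_eq_div, le_div_iff₀ hk0] at ha ⊢
    push_cast at hb
    rw [← mul_assoc] at hb
    linarith
  refine ⟨M₁, N₁, hM₁, hN₁, c.toIDCode hU hV, hrate hcM hlogM, hrate hcN hlogN, ?_, ?_⟩
  · exact (c.error₁_toIDCode_le _ hU hV hη (by positivity)).trans h12₁
  · have := c.error₂_toIDCode_le _ hU hV hη (by positivity) hr1 hUU hVV
    linarith
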